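/- Let $d\in\mathbb N$ and $p,q\in\mathbb R$ satisfy $2-d\le p<0<q\le 2$ (so $d\ge 3$), and let $K:\mathbb R^d\to[0,+\infty]$, $K(x)=\frac{|x|^q}{q}-\frac{|x|^p}{p}$ for $x\ne 0$ and $K(0)=+\infty$. Let $\varphi\in C^\infty(\mathbb R^d)$ be radial and nonnegative with $\int_{\mathbb R^d}\varphi\,dx=1$ and $\varphi(x)\le C|x|^{-l}$ for all $x\neq0$, for some $l\ge\max\{2d+1,4\}$ and $C>0$. For $\epsilon>0$ put $\varphi_\epsilon(x)=\epsilon^{-d}\varphi(x/\epsilon)$ and $K_\epsilon=\varphi_\epsilon*K*\varphi_\epsilon$. For a probability measure $\mu$ on $\mathbb R^d$ let $$E(\mu)=\iint K(x-y)\,d\mu(x)\,d\mu(y),\qquad E_\epsilon(\mu)=\iint K_\epsilon(x-y)\,d\mu(x)\,d\mu(y),$$ with values in $[0,+\infty]$. Let $\mathcal P(\mathbb R^d)$ be the set of Borel probability measures on $\mathbb R^d$ and $\mathcal P_2(\mathbb R^d)$ the subset of those with $\int|x|^2\,d\mu<\infty$. Then $E$ has a minimizer in $\mathcal P_2(\mathbb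 R^d)$: there is $\mu\in\mathcal P_2(\mathbb R^d)$ with $E(\mu)\le E(\nu)$ for all $\nu\in\mathcal P(\mathbb R^d)$, in particular for all $\nu\in\mathcal P_2(\mathbb R^d)$. Moreover there is $\epsilon_0>0$ such that for every $0<\epsilon<\epsilon_0$ there is $\mu_\epsilon\in\mathcal P_2(\mathbb R^d)$ with $E_\epsilon(\mu_\epsilon)\le E_\epsilon(\nu)$ for all $\nu\in\mathcal P(\mathbb R^d)$, in particular for all $\nu\in\mathcal P_2(\mathbb R^d)$. -/

import Mathlib

open MeasureTheory
open scoped ENNReal ContDiff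

/-- The repulsive-attractive power-law kernel `K(x) = |x|^q / q - |x|^p / p` on `ℝ^d`, for exponents
`p < 0 < q`. It is nonnegative (see `powerLaw_nonneg`), so taking values in `[0, ∞]` loses nothing,
and `K(0) = +∞` because `p < 0`. -/
noncomputable def powerLawKernel (d : ℕ) (p q : ℝ) (x : EuclideanSpace ℝ (Fin d)) : ℝ≥0∞ :=
  open Classical in
  if x = 0 then ⊤ else ENNReal.ofReal (‖x‖ ^ q / q - ‖x‖ ^ p / p)

theorem powerLaw_nonneg {p q r : ℝ} (hp : p < 0) (hq : 0 < q) (hr : 0 ≤ r) :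
    0 ≤ r ^ q / q - r ^ p / p := by
  have h1 : 0 ≤ r ^ q / q := div_nonneg (Real.rpow_nonneg hr q) hq.le
  have h2 : r ^ p / p ≤ 0 := div_nonpos_of_nonneg_of_nonpos (Real.rpow_nonneg hr p) hp.le
  linarith

/-- The interaction energy `∬ K(x - y) dμ(x) dμ(y)` of a probability measure `μ` on `ℝ^d`, for a
kernel `K` with values in `[0, ∞]`. -/
noncomputable def interactionEnergy {d : ℕ} (K : EuclideanSpace ℝ (Fin d) → ℝ≥0∞)
    (μ : ProbabilityMeasure (EuclideanSpace ℝ (Fin d))) : ℝ≥0∞ :=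
  ∫⁻ y, ∫⁻ x, K (x - y) ∂(μ : Measure (EuclideanSpace ℝ (Fin d)))
    ∂(μ : Measure (EuclideanSpace ℝ (Fin d)))

/-- Admissible mollifiers on `ℝ^d`: smooth, radial, nonnegative, of integral one, and with
`φ(x) ≤ C |x|^(-l)` for some `l ≥ max {2 d + 1, 4}` and `C > 0`. -/
structure IsAdmissibleMollifier {d : ℕ} (φ : EuclideanSpace ℝ (Fin d) → ℝ) : Prop where
  smooth : ContDiff ℝ ∞ φ
  radial : ∀ x y, ‖x‖ = ‖y‖ → φ x = φ y
  nonneg : ∀ x, 0 ≤ φ x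
  integral_eq_one : ∫ x, φ x = 1
  decay : ∃ l C : ℝ, max (2 * (d : ℝ) + 1) 4 ≤ l ∧ 0 < C ∧ ∀ x, x ≠ 0 → φ x ≤ C * ‖x‖ ^ (-l)

/-- The rescaled mollifier `φ_ε(x) = ε^(-d) φ(x / ε)`. -/
noncomputable def rescaledMollifier {d : ℕ} (φ : EuclideanSpace ℝ (Fin d) → ℝ) (ε : ℝ)
    (x : EuclideanSpace ℝ (Fin d)) : ℝ :=
  (ε ^ d)⁻¹ * φ (ε⁻¹ • x)

/-- The regularized kernel `K_ε = φ_ε * K * φ_ε`, for a nonnegative mollifier `φ`. All functions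
being nonnegative, the convolutions are Lebesgue integrals with values in `[0, ∞]`. -/
noncomputable def regularizedKernel {d : ℕ} (φ : EuclideanSpace ℝ (Fin d) → ℝ)
    (K : EuclideanSpace ℝ (Fin d) → ℝ≥0∞) (ε : ℝ) : EuclideanSpace ℝ (Fin d) → ℝ≥0∞ :=
  lconvolution (lconvolution (fun x => ENNReal.ofReal (rescaledMollifier φ ε x)) K volume)
    (fun x => ENNReal.ofReal (rescaledMollifier φ ε x)) volume

/-- The set `P_2(ℝ^d)` of probability measures on `ℝ^d` with finite second moment. -/
def finiteSecondMoment (d : ℕ) : Set (ProbabilityMeasure (EuclideanSpace ℝ (Fin d))) :=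
  {μ | ∫⁻ x, ENNReal.ofReal (‖x‖ ^ 2) ∂(μ : Measure (EuclideanSpace ℝ (Fin d))) < ⊤}

/-! This is the direct method, applied to any kernel with three properties: it is lower
semicontinuous, it tends to `∞` at infinity, and some measure has finite energy
(`exists_mem_finiteSecondMoment_isMinOn`).

Translation invariance lets minimizing sequences drift, so compactness holds only after recentring.
If the energy of `μ` is at most `M`, some point sees potential at most `M`, so most of the mass lies
near it. This makes the recentred measures uniformly tight
(`exists_isCompact_forall_exists_translate_mem`). A minimizer is compactly supported, since cutting
off a far tail and renormalizing would lower the energy.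

The power-law kernel has all three properties. The first two survive convolution with `φ_ε` by
Fatou. Finite energy follows from `IsQuadraticallyBounded`, which survives because `φ_ε` has a
finite second moment. -/

open Filter Topology Set
open scoped NNReal

/-! ### Lower semicontinuity of integrals under weak convergence -/

section LowerSemicontinuity

variable {Ω : Type*} [TopologicalSpace Ω] [TopologicalSpace.PseudoMetrizableSpace Ω]
  [TopologicalSpace.SeparableSpace Ω] [MeasurableSpace Ω] [BorelSpace Ω]

/-- The integral of a bounded lower semicontinuous function is lower semicontinuous for the weak
convergence of probability measures. -/
theorem lowerSemicontinuous_lintegral_of_le_coe {f : Ω → ℝ≥0∞} (hf : LowerSemicontinuous f)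
    {C : ℝ≥0} (hC : ∀ x, f x ≤ C) :
    LowerSemicontinuous fun μ : ProbabilityMeasure Ω => ∫⁻ x, f x ∂(μ : Measure Ω) := by
  have hfin : ∀ x, f x ≠ ⊤ := fun x => ((hC x).trans_lt ENNReal.coe_lt_top).ne
  -- Layer cake: superlevel sets of `f` are open, so the portmanteau theorem applies at each height
  -- `t`, and Fatou passes to the integral over `t`.
  have hcake : ∀ μ : ProbabilityMeasure Ω, ∫⁻ x, f x ∂(μ : Measure Ω) =
      ∫⁻ t in Ioi (0 : ℝ), (μ : Measure Ω) {x | t < (f x).toReal} := by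
    intro μ
    rw [← lintegral_eq_lintegral_meas_lt _ (Eventually.of_forall fun _ => ENNReal.toReal_nonneg)
      hf.measurable.ennreal_toReal.aemeasurable]
    exact lintegral_congr fun x => (ENNReal.ofReal_toReal (hfin x)).symm
  simp only [hcake]
  refine lowerSemicontinuous_iff_le_liminf.2 fun μ => ?_
  refine le_trans (setLIntegral_mono' measurableSet_Ioi fun t ht => ?_)
    (lintegral_liminf_le fun ν => Antitone.measurable fun s t hst =>
      measure_mono fun x hx => lt_of_le_of_lt hst hx)
  refine ProbabilityMeasure.le_liminf_measure_open_of_tendsto tendsto_id ?_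
  have : {x | t < (f x).toReal} = f ⁻¹' Ioi (ENNReal.ofReal t) := by
    ext x
    exact (ENNReal.ofReal_lt_iff_lt_toReal (le_of_lt ht) (hfin x)).symm
  rw [this]
  exact hf.isOpen_preimage _

/-- The integral of a nonnegative lower semicontinuous function is lower semicontinuous for the
weak convergence of probability measures. -/
theorem LowerSemicontinuous.lowerSemicontinuous_lintegral {f : Ω → ℝ≥0∞}
    (hf : LowerSemicontinuous f) :
    LowerSemicontinuous fun μ : ProbabilityMeasure Ω => ∫⁻ x, f x ∂(μ : Measure Ω) := by
  have hsup : ∀ x, ⨆ n : ℕ, min (f x) ((n : ℝ≥0) : ℝ≥0∞) = f x := by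
    intro x
    rw [← inf_iSup_eq]
    simp [ENNReal.iSup_natCast]
  have hlsc : ∀ n : ℕ, LowerSemicontinuous fun x => min (f x) ((n : ℝ≥0) : ℝ≥0∞) :=
    fun n => hf.inf lowerSemicontinuous_const
  have heq : ∀ μ : ProbabilityMeasure Ω, ∫⁻ x, f x ∂(μ : Measure Ω) =
      ⨆ n : ℕ, ∫⁻ x, min (f x) ((n : ℝ≥0) : ℝ≥0∞) ∂(μ : Measure Ω) := by
    intro μ
    rw [← lintegral_iSup (fun n => (hlsc n).measurable)]
    · simp only [hsup]
    · intro m n hmn x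
      exact min_le_min le_rfl (by simpa using hmn)
  simp only [heq]
  exact lowerSemicontinuous_iSup fun n =>
    lowerSemicontinuous_lintegral_of_le_coe (hlsc n) fun x => min_le_right _ _

end LowerSemicontinuity

/-! ### Energy: semicontinuity, invariance, concentration of mass -/

section Energy

variable {d : ℕ} {K : EuclideanSpace ℝ (Fin d) → ℝ≥0∞}

theorem interactionEnergy_eq_lintegral_prod (hK : Measurable K)
    (μ : ProbabilityMeasure (EuclideanSpace ℝ (Fin d))) :
    interactionEnergy K μ =
      ∫⁻ z : EuclideanSpace ℝ (Fin d) × EuclideanSpace ℝ (Fin d), K (z.2 - z.1)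
        ∂(μ.prod μ).toMeasure := by
  rw [ProbabilityMeasure.toMeasure_prod, lintegral_prod _ (by fun_prop)]
  rfl

theorem lowerSemicontinuous_interactionEnergy (hK : LowerSemicontinuous K) :
    LowerSemicontinuous (interactionEnergy K) := by
  have h : LowerSemicontinuous fun z : EuclideanSpace ℝ (Fin d) × EuclideanSpace ℝ (Fin d) =>
      K (z.2 - z.1) := hK.comp (by fun_prop)
  have h2 := h.lowerSemicontinuous_lintegral.comp
    (g := fun μ : ProbabilityMeasure (EuclideanSpace ℝ (Fin d)) => μ.prod μ)
    (ProbabilityMeasure.continuous_prod.comp (continuous_id.prodMk continuous_id))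
  convert h2 using 1
  exact funext fun μ => interactionEnergy_eq_lintegral_prod hK.measurable μ

/-- The interaction energy is invariant under translations. -/
theorem interactionEnergy_map_sub_right (μ : ProbabilityMeasure (EuclideanSpace ℝ (Fin d)))
    (a : EuclideanSpace ℝ (Fin d)) :
    interactionEnergy K (μ.map (f := fun x => x - a) (by fun_prop)) = interactionEnergy K μ := by
  have he : MeasurableEmbedding fun x : EuclideanSpace ℝ (Fin d) => x - a :=
    (Homeomorph.subRight a).measurableEmbedding
  simp only [interactionEnergy, ProbabilityMeasure.toMeasure_map, he.lintegral_map,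
    sub_sub_sub_cancel_right]

/-- A measure of energy at most `M` gives almost all its mass to some ball, of a radius that depends
on `M` and the kernel only. -/
theorem exists_measure_compl_closedBall_lt {M : ℝ≥0∞} (hM : M ≠ ⊤) {u : ℝ≥0} (hu : u ≠ 0) {R : ℝ}
    (hR : ∀ x, R < ‖x‖ → (M + 1) / u ≤ K x)
    {μ : ProbabilityMeasure (EuclideanSpace ℝ (Fin d))} (hμ : interactionEnergy K μ ≤ M) :
    ∃ y, (μ : Measure (EuclideanSpace ℝ (Fin d))) (Metric.closedBall y R)ᶜ < u := by
  -- If every ball of radius `R` missed mass at least `u`, the potential would be at least `(M + 1)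
  -- / u * u = M + 1` at every point, and so would the energy.
  by_contra! h
  have hu' : (u : ℝ≥0∞) ≠ 0 := by exact_mod_cast hu
  have : M + 1 ≤ interactionEnergy K μ := by
    calc M + 1 = ∫⁻ _, (M + 1) ∂(μ : Measure (EuclideanSpace ℝ (Fin d))) := by simp
      _ ≤ _ := lintegral_mono fun y => ?_
    calc M + 1 = (M + 1) / u * u := (ENNReal.div_mul_cancel hu' ENNReal.coe_ne_top).symm
      _ ≤ (M + 1) / u * (μ : Measure (EuclideanSpace ℝ (Fin d))) (Metric.closedBall y R)ᶜ := by
        gcongr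
        exact h y
      _ = ∫⁻ _ in (Metric.closedBall y R)ᶜ, (M + 1) / u ∂(μ : Measure _) := by simp
      _ ≤ ∫⁻ x in (Metric.closedBall y R)ᶜ, K (x - y) ∂(μ : Measure _) :=
        setLIntegral_mono' Metric.isClosed_closedBall.measurableSet.compl fun x hx => hR _ (by
          simpa [dist_eq_norm] using hx)
      _ ≤ _ := setLIntegral_le_lintegral _ _
  exact absurd (this.trans hμ) (not_le.2 (ENNReal.lt_add_right hM one_ne_zero))

/-- Two balls that both miss less than half of the mass intersect. -/
theorem dist_le_add_of_measure_compl_closedBall_lt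
    {μ : ProbabilityMeasure (EuclideanSpace ℝ (Fin d))} {y z : EuclideanSpace ℝ (Fin d)} {r s : ℝ}
    {u v : ℝ≥0} (huv : u + v ≤ 1)
    (hy : (μ : Measure (EuclideanSpace ℝ (Fin d))) (Metric.closedBall y r)ᶜ < u)
    (hz : (μ : Measure (EuclideanSpace ℝ (Fin d))) (Metric.closedBall z s)ᶜ < v) :
    dist y z ≤ r + s := by
  by_contra! h
  have hdisj : Disjoint (Metric.closedBall y r) (Metric.closedBall z s) :=
    Metric.closedBall_disjoint_closedBall h
  have h1 : (1 : ℝ≥0∞) ≤ (μ : Measure (EuclideanSpace ℝ (Fin d))) (Metric.closedBall y r)ᶜ +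
      (μ : Measure (EuclideanSpace ℝ (Fin d))) (Metric.closedBall z s)ᶜ := by
    calc (1 : ℝ≥0∞) = (μ : Measure (EuclideanSpace ℝ (Fin d))) univ := by simp
      _ ≤ _ := measure_mono (t := (Metric.closedBall y r)ᶜ ∪ (Metric.closedBall z s)ᶜ) (by
        rw [← compl_inter, hdisj.inter_eq, compl_empty])
      _ ≤ _ := measure_union_le _ _
  have h2 := h1.trans_lt (ENNReal.add_lt_add hy hz)
  exact absurd h2 (not_lt.2 (by exact_mod_cast huv))

end Energy

/-! ### Existence and compact support of minimizers -/

section Existence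

variable {d : ℕ} {K : EuclideanSpace ℝ (Fin d) → ℝ≥0∞}

theorem exists_radius_of_tendsto_top (hK : Tendsto K (cocompact _) (𝓝 ⊤)) {L : ℝ≥0∞} (hL : L ≠ ⊤) :
    ∃ R : ℝ, 0 ≤ R ∧ ∀ x, R < ‖x‖ → L ≤ K x := by
  have h := hK.eventually (lt_mem_nhds hL.lt_top)
  rw [← Metric.cobounded_eq_cocompact, ← comap_norm_atTop, eventually_comap,
    eventually_atTop] at h
  obtain ⟨R, hR⟩ := h
  exact ⟨max R 0, le_max_right _ _, fun x hx => (hR _ ((le_max_left _ _).trans hx.le) x rfl).le⟩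

/-- Up to translation, the measures of energy at most `M` lie in a weakly compact set. -/
theorem exists_isCompact_forall_exists_translate_mem (hK : Tendsto K (cocompact _) (𝓝 ⊤))
    {M : ℝ≥0∞} (hM : M ≠ ⊤) :
    ∃ T : Set (ProbabilityMeasure (EuclideanSpace ℝ (Fin d))), IsCompact T ∧
      ∀ μ, interactionEnergy K μ ≤ M → ∃ a : EuclideanSpace ℝ (Fin d),
        μ.map (f := fun x => x - a) (by fun_prop) ∈ T := by
  -- The shift gives `u n = 1 / (n + 2)`, so `u 0 + u n ≤ 1`: each ball of level `n` must meet the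
  -- ball of level `0`. Hence the single centre `y 0` serves all levels, with radius `R 0 + 2 * R
  -- n`.
  set u : ℕ → ℝ≥0 := fun n => 1 / ((n + 1 : ℕ) + 1 : ℝ≥0) with hu
  have hu0 : ∀ n, u n ≠ 0 := fun n => by positivity
  have hu2 : ∀ n, u 0 + u n ≤ 1 := by
    intro n
    have h1 : u n ≤ 1 / 2 := by
      refine one_div_le_one_div_of_le two_pos ?_
      push_cast
      rw [add_assoc, one_add_one_eq_two]
      exact le_add_of_nonneg_left (zero_le)
    have h2 : u 0 = 1 / 2 := by simp [hu, one_add_one_eq_two]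
    calc u 0 + u n ≤ 1 / 2 + 1 / 2 := add_le_add h2.le h1
      _ = 1 := add_halves 1
  have hlim : Tendsto u atTop (𝓝 0) :=
    (tendsto_one_div_add_atTop_nhds_zero_nat (𝕜 := ℝ≥0)).comp (tendsto_add_atTop_nat 1)
  have hL : ∀ n, (M + 1) / (u n : ℝ≥0∞) ≠ ⊤ := fun n =>
    ENNReal.div_ne_top (ENNReal.add_ne_top.2 ⟨hM, ENNReal.one_ne_top⟩) (by simpa using hu0 n)
  choose R hR0 hR using fun n => exists_radius_of_tendsto_top hK (hL n)
  refine ⟨{μ | ∀ n, μ (Metric.closedBall 0 (R 0 + 2 * R n))ᶜ ≤ u n},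
    isCompact_setOfPred_probabilityMeasure_mass_eq_compl_isCompact_le hlim
      (fun n => isCompact_closedBall _ _) (Or.inl inferInstance), fun μ hμ => ?_⟩
  choose y hy using fun n => exists_measure_compl_closedBall_lt hM (hu0 n) (hR n) hμ
  refine ⟨y 0, fun n => ?_⟩
  rw [← ENNReal.coe_le_coe, ProbabilityMeasure.ennreal_coeFn_eq_coeFn_toMeasure,
    ProbabilityMeasure.toMeasure_map,
    Measure.map_apply (by fun_prop) Metric.isClosed_closedBall.measurableSet.compl]
  refine (measure_mono fun x hx => ?_).trans (hy n).le
  contrapose! hx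
  have h1 : dist (y 0) (y n) ≤ R 0 + R n :=
    dist_le_add_of_measure_compl_closedBall_lt (hu2 n) (hy 0) (hy n)
  have h2 : dist x (y n) ≤ R n := by simpa using hx
  have h3 := dist_triangle_right x (y 0) (y n)
  simp only [preimage_compl, mem_compl_iff, mem_preimage, mem_closedBall_zero_iff, not_not,
    ← dist_eq_norm]
  linarith

/-- The direct method: the interaction energy of a lower semicontinuous kernel that tends to `∞` at
infinity has a minimizer. -/
theorem exists_isMinOn_interactionEnergy (hK : LowerSemicontinuous K)
    (hK' : Tendsto K (cocompact _) (𝓝 ⊤))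
    {μ₀ : ProbabilityMeasure (EuclideanSpace ℝ (Fin d))} (hμ₀ : interactionEnergy K μ₀ ≠ ⊤) :
    ∃ μ, IsMinOn (interactionEnergy K) univ μ := by
  obtain ⟨T, hT, h⟩ := exists_isCompact_forall_exists_translate_mem hK' hμ₀
  obtain ⟨a₀, ha₀⟩ := h μ₀ le_rfl
  obtain ⟨μ, -, hμ⟩ := LowerSemicontinuousOn.exists_isMinOn ⟨_, ha₀⟩ hT
    ((lowerSemicontinuous_interactionEnergy hK).lowerSemicontinuousOn T)
  have key : ∀ ν, interactionEnergy K ν ≤ interactionEnergy K μ₀ →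
      interactionEnergy K μ ≤ interactionEnergy K ν := by
    intro ν hν
    obtain ⟨a, ha⟩ := h ν hν
    simpa only [interactionEnergy_map_sub_right] using isMinOn_iff.1 hμ _ ha
  refine ⟨μ, isMinOn_iff.2 fun ν _ => ?_⟩
  rcases le_total (interactionEnergy K ν) (interactionEnergy K μ₀) with hν | hν
  · exact key ν hν
  · exact (key μ₀ le_rfl).trans hν

/-- A minimizer of finite energy is supported in a ball: conditioning on a large ball would
otherwise lower the energy. -/
theorem exists_measure_compl_closedBall_eq_zero_of_isMinOn (hK : Measurable K)
    (hK' : Tendsto K (cocompact _) (𝓝 ⊤))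
    {μ : ProbabilityMeasure (EuclideanSpace ℝ (Fin d))}
    (hμ : IsMinOn (interactionEnergy K) univ μ) (hfin : interactionEnergy K μ ≠ ⊤) :
    ∃ R : ℝ, (μ : Measure (EuclideanSpace ℝ (Fin d))) (Metric.closedBall 0 R)ᶜ = 0 := by
  set m := interactionEnergy K μ with hm
  set P : Measure (EuclideanSpace ℝ (Fin d)) := (μ : Measure (EuclideanSpace ℝ (Fin d))) with hP
  obtain ⟨R₀, hR₀⟩ : ∃ R₀ : ℝ, 1 / 2 ≤ P (Metric.closedBall 0 R₀) := by
    have hmono : Monotone fun n : ℕ => Metric.closedBall (0 : EuclideanSpace ℝ (Fin d)) n :=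
      fun i j hij => Metric.closedBall_subset_closedBall (by exact_mod_cast hij)
    have h := tendsto_measure_iUnion_atTop (μ := P) hmono
    rw [Metric.iUnion_closedBall_nat, hP, measure_univ] at h
    obtain ⟨n, hn⟩ := (h.eventually (lt_mem_nhds ENNReal.one_half_lt_one)).exists
    exact ⟨n, by simpa using hn.le⟩
  -- The core ball of radius `R₀` carries at least half the mass, so the level `2 * (m + 1)` makes
  -- each point outside `B` interact with it at cost at least `m + 1`.
  obtain ⟨R₁, hR₁0, hR₁⟩ := exists_radius_of_tendsto_top hK' (L := 2 * (m + 1))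
    (ENNReal.mul_ne_top ENNReal.ofNat_ne_top (ENNReal.add_ne_top.2 ⟨hfin, ENNReal.one_ne_top⟩))
  refine ⟨R₀ + R₁, ?_⟩
  set B := Metric.closedBall (0 : EuclideanSpace ℝ (Fin d)) (R₀ + R₁) with hB
  have hBm : MeasurableSet B := Metric.isClosed_closedBall.measurableSet
  have hsub : Metric.closedBall 0 R₀ ⊆ B := Metric.closedBall_subset_closedBall (by linarith)
  have hfar : ∀ x ∈ Bᶜ, ∀ y ∈ Metric.closedBall (0 : EuclideanSpace ℝ (Fin d)) R₀,
      R₁ < ‖x - y‖ := by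
    intro x hx y hy
    rw [hB, mem_compl_iff, mem_closedBall_zero_iff, not_le] at hx
    rw [mem_closedBall_zero_iff] at hy
    linarith [norm_sub_norm_le x y]
  have hhalf : ∀ g : EuclideanSpace ℝ (Fin d) → ℝ≥0∞,
      (∀ y ∈ Metric.closedBall (0 : EuclideanSpace ℝ (Fin d)) R₀, 2 * (m + 1) ≤ g y) →
      m + 1 ≤ ∫⁻ y in B, g y ∂P := by
    intro g hg
    calc m + 1 = 2 * (m + 1) * (1 / 2) := by
          rw [mul_comm 2, mul_assoc, one_div,
            ENNReal.mul_inv_cancel two_ne_zero ENNReal.ofNat_ne_top, mul_one]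
      _ ≤ 2 * (m + 1) * P (Metric.closedBall 0 R₀) := by gcongr
      _ = ∫⁻ _ in Metric.closedBall 0 R₀, 2 * (m + 1) ∂P := by simp
      _ ≤ ∫⁻ y in Metric.closedBall 0 R₀, g y ∂P :=
        setLIntegral_mono' Metric.isClosed_closedBall.measurableSet hg
      _ ≤ _ := lintegral_mono_set hsub
  set b := P B with hb
  set s := P Bᶜ with hs
  have hbs : b + s = 1 := by
    rw [hb, hs, measure_add_measure_compl hBm, hP, measure_univ]
  have hb0 : b ≠ 0 := by
    have : (1 / 2 : ℝ≥0∞) ≤ b := hR₀.trans (measure_mono hsub)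
    intro h0
    rw [h0] at this
    simp at this
  have hbt : b ≠ ⊤ := measure_ne_top _ _
  -- comparison with the conditioned measure
  have hcond : m * b ^ 2 ≤ ∫⁻ y in B, ∫⁻ x in B, K (x - y) ∂P ∂P := by
    have : IsProbabilityMeasure (ProbabilityTheory.cond P B) :=
      ProbabilityTheory.cond_isProbabilityMeasure hb0
    have h : m ≤ ∫⁻ y, ∫⁻ x, K (x - y) ∂(b⁻¹ • P.restrict B) ∂(b⁻¹ • P.restrict B) :=
      isMinOn_iff.1 hμ ⟨ProbabilityTheory.cond P B, this⟩ (mem_univ _)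
    simp only [lintegral_smul_measure, smul_eq_mul] at h
    rw [lintegral_const_mul' _ _ (ENNReal.inv_ne_top.2 hb0), ← mul_assoc] at h
    calc m * b ^ 2 ≤ (b⁻¹ * b⁻¹ * ∫⁻ y in B, ∫⁻ x in B, K (x - y) ∂P ∂P) * b ^ 2 := by
          gcongr
      _ = (b⁻¹ * b) * (b⁻¹ * b) * ∫⁻ y in B, ∫⁻ x in B, K (x - y) ∂P ∂P := by ring
      _ = _ := by rw [ENNReal.inv_mul_cancel hb0 hbt, one_mul, one_mul]
  have hmeas : Measurable fun z : EuclideanSpace ℝ (Fin d) × EuclideanSpace ℝ (Fin d) =>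
      K (z.2 - z.1) := by fun_prop
  -- Both cross terms between `B` and its complement count. With `b = 1 - s` the inequality reads `m
  -- * s ^ 2 + 2 * s ≤ 0`, which forces `s = 0`.
  have hsplit : m * b ^ 2 + (m + 1) * s + (m + 1) * s ≤ m := by
    calc m * b ^ 2 + (m + 1) * s + (m + 1) * s
        ≤ (∫⁻ y in B, ∫⁻ x in B, K (x - y) ∂P ∂P) + (∫⁻ x in Bᶜ, ∫⁻ y in B, K (x - y) ∂P ∂P)
          + ∫⁻ y in Bᶜ, ∫⁻ x in B, K (x - y) ∂P ∂P := by
          gcongr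
          · calc (m + 1) * s = ∫⁻ _ in Bᶜ, (m + 1) ∂P := by simp [hs]
              _ ≤ _ := setLIntegral_mono' hBm.compl fun x hx =>
                hhalf _ fun y hy => hR₁ _ (hfar x hx y hy)
          · calc (m + 1) * s = ∫⁻ _ in Bᶜ, (m + 1) ∂P := by simp [hs]
              _ ≤ _ := setLIntegral_mono' hBm.compl fun y hy =>
                hhalf _ fun x hx => hR₁ _ (by rw [norm_sub_rev]; exact hfar y hy x hx)
      _ = (∫⁻ y in B, ∫⁻ x in B, K (x - y) ∂P ∂P) + (∫⁻ y in B, ∫⁻ x in Bᶜ, K (x - y) ∂P ∂P)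
          + ∫⁻ y in Bᶜ, ∫⁻ x in B, K (x - y) ∂P ∂P := by
          rw [lintegral_lintegral_swap (μ := P.restrict Bᶜ) (by fun_prop)]
      _ = (∫⁻ y in B, ∫⁻ x, K (x - y) ∂P ∂P) + ∫⁻ y in Bᶜ, ∫⁻ x in B, K (x - y) ∂P ∂P := by
          rw [← lintegral_add_left hmeas.lintegral_prod_right']
          simp only [lintegral_add_compl _ hBm]
      _ ≤ (∫⁻ y in B, ∫⁻ x, K (x - y) ∂P ∂P) + ∫⁻ y in Bᶜ, ∫⁻ x, K (x - y) ∂P ∂P := by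
          gcongr
          exact Measure.restrict_le_self
      _ = m := lintegral_add_compl _ hBm
  have hst : s ≠ ⊤ := measure_ne_top _ _
  clear_value m b s
  lift m to ℝ≥0 using hfin
  lift b to ℝ≥0 using hbt
  lift s to ℝ≥0 using hst
  norm_cast at hsplit hbs ⊢
  have h1 : (b : ℝ) + s = 1 := by exact_mod_cast hbs
  have h2 : (m : ℝ) * b ^ 2 + (m + 1) * s + (m + 1) * s ≤ m := by exact_mod_cast hsplit
  have h3 : (s : ℝ) ≤ 0 := by
    have : (b : ℝ) = 1 - s := by linarith
    rw [this] at h2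
    nlinarith [mul_nonneg m.coe_nonneg (sq_nonneg (s : ℝ)), s.coe_nonneg]
  exact le_antisymm (by exact_mod_cast h3) zero_le

theorem mem_finiteSecondMoment_of_measure_compl_closedBall_eq_zero
    {μ : ProbabilityMeasure (EuclideanSpace ℝ (Fin d))} {R : ℝ}
    (hμ : (μ : Measure (EuclideanSpace ℝ (Fin d))) (Metric.closedBall 0 R)ᶜ = 0) :
    μ ∈ finiteSecondMoment d := by
  have h : ∀ᵐ x ∂(μ : Measure (EuclideanSpace ℝ (Fin d))),
      ENNReal.ofReal (‖x‖ ^ 2) ≤ ENNReal.ofReal (R ^ 2) := by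
    filter_upwards [compl_mem_ae_iff.2 hμ] with x hx
    rw [compl_compl, mem_closedBall_zero_iff] at hx
    gcongr
  calc _ ≤ ∫⁻ _, ENNReal.ofReal (R ^ 2) ∂(μ : Measure (EuclideanSpace ℝ (Fin d))) :=
        lintegral_mono_ae h
    _ < ⊤ := by simp

/-- The interaction energy of a lower semicontinuous kernel that tends to `∞` at infinity has a
minimizer with finite second moment, provided that some measure has finite energy. -/
theorem exists_mem_finiteSecondMoment_isMinOn (hK : LowerSemicontinuous K)
    (hK' : Tendsto K (cocompact _) (𝓝 ⊤)) (h : ∃ μ₀, interactionEnergy K μ₀ ≠ ⊤) :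
    ∃ μ ∈ finiteSecondMoment d, IsMinOn (interactionEnergy K) univ μ := by
  obtain ⟨μ₀, hμ₀⟩ := h
  obtain ⟨μ, hμ⟩ := exists_isMinOn_interactionEnergy hK hK' hμ₀
  have hfin := ne_top_of_le_ne_top hμ₀ (isMinOn_iff.1 hμ μ₀ (mem_univ _))
  obtain ⟨R, hR⟩ :=
    exists_measure_compl_closedBall_eq_zero_of_isMinOn hK.measurable hK' hμ hfin
  exact ⟨μ, mem_finiteSecondMoment_of_measure_compl_closedBall_eq_zero hR, hμ⟩

end Existence

/-! ### Continuity and growth of the power-law kernel -/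

section Kernels

variable {d : ℕ}

/-- At the origin the lower bound `|x|^p / (-p)` blows up, which matches the value `⊤` there. -/
theorem continuous_powerLawKernel {p q : ℝ} (hp : p < 0) (hq : 0 < q) :
    Continuous (powerLawKernel d p q) := by
  refine continuous_iff_continuousAt.2 fun x => ?_
  rcases eq_or_ne x 0 with rfl | hx
  · rw [continuousAt_iff_punctured_nhds]
    have h0 : powerLawKernel d p q 0 = ⊤ := by simp [powerLawKernel]
    have hlow : ∀ᶠ x : EuclideanSpace ℝ (Fin d) in 𝓝[≠] 0,
        ENNReal.ofReal (‖x‖ ^ p / (-p)) ≤ powerLawKernel d p q x := by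
      filter_upwards [self_mem_nhdsWithin] with x hx
      rw [powerLawKernel, if_neg (by simpa using hx)]
      have : 0 ≤ ‖x‖ ^ q / q := by positivity
      exact ENNReal.ofReal_le_ofReal (by rw [div_neg]; linarith)
    rw [h0]
    refine tendsto_nhds_top_mono (ENNReal.tendsto_ofReal_atTop.comp ?_) hlow
    exact ((tendsto_rpow_neg_nhdsGT_zero hp).comp tendsto_norm_nhdsNE_zero).atTop_div_const
      (neg_pos.2 hp)
  · have heq : (fun x => ENNReal.ofReal (‖x‖ ^ q / q - ‖x‖ ^ p / p)) =ᶠ[𝓝 x]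
        powerLawKernel d p q := by
      filter_upwards [isOpen_ne.mem_nhds hx] with y hy
      rw [powerLawKernel, if_neg hy]
    refine ContinuousAt.congr (ENNReal.continuous_ofReal.continuousAt.comp ?_) heq
    have hn := norm_ne_zero_iff.2 hx
    exact ((continuous_norm.continuousAt.rpow_const (Or.inl hn)).div_const q).sub
      ((continuous_norm.continuousAt.rpow_const (Or.inl hn)).div_const p)

theorem tendsto_powerLawKernel_cocompact {p q : ℝ} (hp : p < 0) (hq : 0 < q) :
    Tendsto (powerLawKernel d p q) (cocompact _) (𝓝 ⊤) := by
  have hlow : ∀ x : EuclideanSpace ℝ (Fin d),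
      ENNReal.ofReal (‖x‖ ^ q / q) ≤ powerLawKernel d p q x := by
    intro x
    unfold powerLawKernel
    split_ifs
    · exact le_top
    · have : ‖x‖ ^ p / p ≤ 0 := div_nonpos_of_nonneg_of_nonpos (by positivity) hp.le
      exact ENNReal.ofReal_le_ofReal (by linarith)
  refine tendsto_nhds_top_mono' (ENNReal.tendsto_ofReal_atTop.comp ?_) hlow
  exact ((tendsto_rpow_atTop hq).comp tendsto_norm_cocompact_atTop).atTop_div_const hq

end Kernels

/-! ### Semicontinuity and growth under convolution -/

section Convolution

variable {d : ℕ} {f g : EuclideanSpace ℝ (Fin d) → ℝ≥0∞}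

/-- Fatou, applied with the translates on `g`. Finiteness of `f` makes multiplication by `f y`
continuous on `[0, ∞]`. -/
theorem LowerSemicontinuous.lconvolution (hf : Measurable f) (hf' : ∀ x, f x ≠ ⊤)
    (hg : LowerSemicontinuous g) : LowerSemicontinuous (lconvolution f g volume) := by
  have hgm := hg.measurable
  refine lowerSemicontinuous_iff_le_liminf.2 fun x => ?_
  refine le_trans (lintegral_mono fun y => ?_) (lintegral_liminf_le fun z => by fun_prop)
  have h : LowerSemicontinuous fun z => f y * g (-y + z) :=
    (ENNReal.continuous_const_mul (hf' y)).comp_lowerSemicontinuous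
      (hg.comp (by fun_prop : Continuous fun z => -y + z)) fun a b hab => mul_le_mul_right hab _
  exact lowerSemicontinuous_iff_le_liminf.1 h x

/-- Fatou along the countably generated filter `cocompact` bounds the liminf below by `∫ f * ⊤`,
which is infinite. -/
theorem tendsto_lconvolution_cocompact (hf : Measurable f) (hf' : ∫⁻ x, f x ≠ 0)
    (hg : Measurable g) (hg' : Tendsto g (cocompact _) (𝓝 ⊤)) :
    Tendsto (lconvolution f g volume) (cocompact _) (𝓝 ⊤) := by
  have : (cocompact (EuclideanSpace ℝ (Fin d))).IsCountablyGenerated := by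
    rw [← Metric.cobounded_eq_cocompact, ← comap_norm_atTop]
    infer_instance
  refine tendsto_of_le_liminf_of_limsup_le ?_ le_top
  calc (⊤ : ℝ≥0∞) = ∫⁻ y, f y * ⊤ := by rw [lintegral_mul_const _ hf, ENNReal.mul_top hf']
    _ ≤ ∫⁻ y, liminf (fun x => f y * g (-y + x)) (cocompact _) := lintegral_mono fun y => ?_
    _ ≤ _ := lintegral_liminf_le fun x => by fun_prop
  rcases eq_or_ne (f y) 0 with hy | hy
  · simp [hy]
  have htrans := hg'.comp (Homeomorph.addLeft (-y)).isClosedEmbedding.tendsto_cocompact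
  -- The filter is trivial when `d = 0`.
  rcases (cocompact (EuclideanSpace ℝ (Fin d))).eq_or_neBot with hbot | hne
  · simp [hbot]
  exact (ENNReal.Tendsto.const_mul htrans (Or.inl ENNReal.top_ne_zero)).liminf_eq.ge

end Convolution

/-! ### Regularized kernels -/

section Mollifier

variable {d : ℕ} {φ : EuclideanSpace ℝ (Fin d) → ℝ}

theorem IsAdmissibleMollifier.measurable_ofReal_rescaledMollifier (hφ : IsAdmissibleMollifier φ)
    (ε : ℝ) : Measurable fun x => ENNReal.ofReal (rescaledMollifier φ ε x) := by
  have := hφ.smooth.continuous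
  unfold rescaledMollifier
  fun_prop

theorem IsAdmissibleMollifier.lintegral_rescaledMollifier_ne_zero (hφ : IsAdmissibleMollifier φ)
    {ε : ℝ} (hε : 0 < ε) : ∫⁻ x, ENNReal.ofReal (rescaledMollifier φ ε x) ≠ 0 := by
  intro h
  rw [lintegral_eq_zero_iff (hφ.measurable_ofReal_rescaledMollifier ε)] at h
  have hint : ∫ x, rescaledMollifier φ ε x = 1 := by
    simp only [rescaledMollifier, integral_const_mul, Measure.integral_comp_inv_smul,
      hφ.integral_eq_one, finrank_euclideanSpace_fin, smul_eq_mul, mul_one]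
    rw [abs_of_pos (pow_pos hε d), inv_mul_cancel₀ (pow_pos hε d).ne']
  have hzero : ∫ x, rescaledMollifier φ ε x = 0 := integral_eq_zero_of_ae <| by
    filter_upwards [h] with x hx
    refine le_antisymm (ENNReal.ofReal_eq_zero.1 hx) ?_
    exact mul_nonneg (by positivity) (hφ.nonneg _)
  exact one_ne_zero (hint.symm.trans hzero)

variable {K : EuclideanSpace ℝ (Fin d) → ℝ≥0∞}

theorem LowerSemicontinuous.regularizedKernel (hφ : IsAdmissibleMollifier φ)
    (hK : LowerSemicontinuous K) (ε : ℝ) : LowerSemicontinuous (regularizedKernel φ K ε) := by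
  have hm := hφ.measurable_ofReal_rescaledMollifier ε
  rw [_root_.regularizedKernel, lconvolution_comm]
  exact .lconvolution hm (by simp) (.lconvolution hm (by simp) hK)

theorem tendsto_regularizedKernel_cocompact (hφ : IsAdmissibleMollifier φ)
    (hK : Measurable K) (hK' : Tendsto K (cocompact _) (𝓝 ⊤)) {ε : ℝ} (hε : 0 < ε) :
    Tendsto (regularizedKernel φ K ε) (cocompact _) (𝓝 ⊤) := by
  have hm := hφ.measurable_ofReal_rescaledMollifier ε
  have h0 := hφ.lintegral_rescaledMollifier_ne_zero hε
  rw [regularizedKernel, lconvolution_comm]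
  exact tendsto_lconvolution_cocompact hm h0 (measurable_lconvolution _ hm hK)
    (tendsto_lconvolution_cocompact hm h0 hK hK')

end Mollifier

/-! ### Quadratic bounds and finite energy -/

section FiniteEnergy

variable {d : ℕ}

/-- A kernel that is bounded by a multiple of `1 + |x|^2`, up to an integrable function. -/
def IsQuadraticallyBounded (K : EuclideanSpace ℝ (Fin d) → ℝ≥0∞) : Prop :=
  ∃ c : ℝ≥0, ∃ h : EuclideanSpace ℝ (Fin d) → ℝ≥0∞, Measurable h ∧ ∫⁻ x, h x ≠ ⊤ ∧
    ∀ᵐ x, K x ≤ c * ENNReal.ofReal (1 + ‖x‖ ^ 2) + h x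

/-- The uniform distribution on the unit ball has finite energy. -/
theorem IsQuadraticallyBounded.exists_interactionEnergy_ne_top
    {K : EuclideanSpace ℝ (Fin d) → ℝ≥0∞} (hK : IsQuadraticallyBounded K) :
    ∃ μ, interactionEnergy K μ ≠ ⊤ := by
  obtain ⟨c, h, hh, hint, hle⟩ := hK
  set B := Metric.closedBall (0 : EuclideanSpace ℝ (Fin d)) 1 with hB
  have hBm : MeasurableSet B := Metric.isClosed_closedBall.measurableSet
  have hB0 : volume B ≠ 0 := (Metric.measure_closedBall_pos volume _ one_pos).ne'
  have hBt : volume B ≠ ⊤ := measure_closedBall_lt_top.ne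
  have hprob : IsProbabilityMeasure (ProbabilityTheory.cond volume B) :=
    ProbabilityTheory.cond_isProbabilityMeasure_of_finite hB0 hBt
  refine ⟨⟨ProbabilityTheory.cond volume B, hprob⟩, ?_⟩
  have heq : interactionEnergy K ⟨ProbabilityTheory.cond volume B, hprob⟩ =
      ∫⁻ y, ∫⁻ x, K (x - y) ∂((volume B)⁻¹ • volume.restrict B)
        ∂((volume B)⁻¹ • volume.restrict B) := rfl
  have hinner : ∀ y ∈ B, ∫⁻ x in B, K (x - y) ≤
      c * ENNReal.ofReal 5 * volume B + ∫⁻ x, h x := by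
    intro y hy
    have hae : ∀ᵐ x, K (x - y) ≤ c * ENNReal.ofReal (1 + ‖x - y‖ ^ 2) + h (x - y) :=
      (measurePreserving_sub_right volume y).quasiMeasurePreserving.ae hle
    -- Points of the unit ball are at distance at most 2, and `5 = 1 + 2 ^ 2`.
    calc ∫⁻ x in B, K (x - y) ≤ ∫⁻ x in B, (c * ENNReal.ofReal 5 + h (x - y)) := by
          refine setLIntegral_mono_ae' hBm ?_
          filter_upwards [hae] with x hx hxB
          refine hx.trans ?_
          gcongr
          have h1 := norm_sub_le x y
          rw [hB, mem_closedBall_zero_iff] at hxB hy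
          nlinarith [norm_nonneg (x - y)]
      _ = c * ENNReal.ofReal 5 * volume B + ∫⁻ x in B, h (x - y) := by
          rw [lintegral_add_left measurable_const, setLIntegral_const]
      _ ≤ c * ENNReal.ofReal 5 * volume B + ∫⁻ x, h (x - y) := by
          gcongr
          exact Measure.restrict_le_self
      _ = _ := by rw [lintegral_sub_right_eq_self h y]
  have hA : c * ENNReal.ofReal 5 * volume B + ∫⁻ x, h x ≠ ⊤ := by finiteness
  simp only [lintegral_smul_measure, smul_eq_mul] at heq
  rw [heq, lintegral_const_mul' _ _ (ENNReal.inv_ne_top.2 hB0)]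
  refine ENNReal.mul_ne_top (ENNReal.inv_ne_top.2 hB0) (ENNReal.mul_ne_top
    (ENNReal.inv_ne_top.2 hB0) (ne_top_of_le_ne_top ?_ (setLIntegral_mono' hBm hinner)))
  rw [setLIntegral_const]
  finiteness

/-- Convolution with a density of finite second moment preserves quadratic bounds. -/
theorem IsQuadraticallyBounded.lconvolution {f K : EuclideanSpace ℝ (Fin d) → ℝ≥0∞}
    (hK : IsQuadraticallyBounded K) (hf : Measurable f)
    (hf' : ∫⁻ x, f x * ENNReal.ofReal (1 + ‖x‖ ^ 2) ≠ ⊤) :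
    IsQuadraticallyBounded (lconvolution f K volume) := by
  obtain ⟨c, h, hh, hint, hle⟩ := hK
  have hf1 : ∫⁻ x, f x ≠ ⊤ := by
    refine ne_top_of_le_ne_top hf' (lintegral_mono fun x => le_mul_of_one_le_right' ?_)
    rw [← ENNReal.ofReal_one]
    exact ENNReal.ofReal_le_ofReal (by nlinarith [sq_nonneg ‖x‖])
  set A := ∫⁻ x, f x * ENNReal.ofReal (1 + ‖x‖ ^ 2) with hA
  refine ⟨c * 2 * A.toNNReal, _, measurable_lconvolution volume hf hh, ?_,
    Eventually.of_forall fun x => ?_⟩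
  · have hm : Measurable fun z : EuclideanSpace ℝ (Fin d) × EuclideanSpace ℝ (Fin d) =>
        f z.2 * h (-z.2 + z.1) := by fun_prop
    simp only [lconvolution_def]
    rw [lintegral_lintegral_swap hm.aemeasurable]
    have : ∀ y, ∫⁻ x, f y * h (-y + x) = f y * ∫⁻ x, h x := fun y => by
      rw [lintegral_const_mul _ (by fun_prop), lintegral_add_left_eq_self h (-y)]
    simp only [this]
    rw [lintegral_mul_const _ hf]
    finiteness
  · have hae : ∀ᵐ y, K (-y + x) ≤ c * ENNReal.ofReal (1 + ‖-y + x‖ ^ 2) + h (-y + x) := by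
      have := (Measure.measurePreserving_sub_left volume x).quasiMeasurePreserving.ae hle
      filter_upwards [this] with y hy
      rwa [neg_add_eq_sub]
    -- Peetre's inequality separates the variables; the factor in `y` is absorbed into the moment
    -- `A`.
    have hpeetre : ∀ y, c * ENNReal.ofReal (1 + ‖-y + x‖ ^ 2) ≤
        c * 2 * ENNReal.ofReal (1 + ‖x‖ ^ 2) * ENNReal.ofReal (1 + ‖y‖ ^ 2) := by
      intro y
      have h0 : 2 * (ENNReal.ofReal (1 + ‖x‖ ^ 2) * ENNReal.ofReal (1 + ‖y‖ ^ 2)) =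
          ENNReal.ofReal (2 * ((1 + ‖x‖ ^ 2) * (1 + ‖y‖ ^ 2))) := by
        rw [ENNReal.ofReal_mul two_pos.le, ENNReal.ofReal_mul (by positivity),
          ENNReal.ofReal_ofNat]
      rw [mul_assoc, mul_assoc, h0]
      refine mul_le_mul_right (ENNReal.ofReal_le_ofReal ?_) _
      have h1 : ‖-y + x‖ ≤ ‖y‖ + ‖x‖ := (norm_add_le _ _).trans_eq (by rw [norm_neg])
      have h2 : ‖-y + x‖ ^ 2 ≤ (‖y‖ + ‖x‖) ^ 2 := by gcongr
      nlinarith [sq_nonneg (‖y‖ - ‖x‖), mul_nonneg (sq_nonneg ‖x‖) (sq_nonneg ‖y‖)]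
    calc ∫⁻ y, f y * K (-y + x)
        ≤ ∫⁻ y, (c * 2 * ENNReal.ofReal (1 + ‖x‖ ^ 2) * (f y * ENNReal.ofReal (1 + ‖y‖ ^ 2))
          + f y * h (-y + x)) := by
          refine lintegral_mono_ae ?_
          filter_upwards [hae] with y hy
          calc f y * K (-y + x) ≤ f y * (c * 2 * ENNReal.ofReal (1 + ‖x‖ ^ 2) *
                ENNReal.ofReal (1 + ‖y‖ ^ 2) + h (-y + x)) := by
                gcongr
                exact hy.trans (add_le_add_left (hpeetre y) _)
            _ = _ := by ring
      _ = c * 2 * ENNReal.ofReal (1 + ‖x‖ ^ 2) * A + ∫⁻ y, f y * h (-y + x) := by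
          rw [lintegral_add_left (by fun_prop), lintegral_const_mul _ (by fun_prop)]
      _ = _ := by
          rw [ENNReal.coe_mul, ENNReal.coe_mul, ENNReal.coe_toNNReal hf', lconvolution_def,
            mul_right_comm, ENNReal.coe_ofNat]

/-- The singularity `|x|^p` is integrable on the unit ball because `p > -d`, and at most 1 outside
it; `|x|^q ≤ 1 + |x|^2` because `0 < q ≤ 2`. -/
theorem isQuadraticallyBounded_powerLawKernel {p q : ℝ} (hd : -(d : ℝ) < p) (hp : p < 0)
    (hq : 0 < q) (hq2 : q ≤ 2) : IsQuadraticallyBounded (powerLawKernel d p q) := by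
  have hd1 : 1 ≤ d := by
    by_contra! h
    have : d = 0 := by omega
    subst this
    simp at hd
    linarith
  have hd1' : 1 ≤ Module.finrank ℝ (EuclideanSpace ℝ (Fin d)) := by simpa using hd1
  have : Nontrivial (EuclideanSpace ℝ (Fin d)) := Module.nontrivial_of_finrank_pos hd1'
  have hint : IntegrableOn (fun x : EuclideanSpace ℝ (Fin d) => ‖x‖ ^ p / -p)
      (Metric.ball 0 1) volume :=
    Integrable.div_const (f := fun x : EuclideanSpace ℝ (Fin d) => ‖x‖ ^ p)
      (integrableOn_ball_of_norm_le_rpow (C := 1) (α := -p) hd1'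
      (by simpa using by linarith)
      (Eventually.of_forall fun x => by
        rw [neg_neg, one_mul, Real.norm_of_nonneg (Real.rpow_nonneg (norm_nonneg x) p)])
      (Measurable.aestronglyMeasurable (by fun_prop))) _
  refine ⟨(1 / q + 1 / -p).toNNReal,
    (Metric.ball 0 1).indicator fun x => ENNReal.ofReal (‖x‖ ^ p / -p),
    Measurable.indicator (by fun_prop) measurableSet_ball, ?_, ?_⟩
  · rw [lintegral_indicator measurableSet_ball]
    exact hint.lintegral_lt_top.ne
  · have h0 : ∀ᵐ x : EuclideanSpace ℝ (Fin d), x ≠ 0 := by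
      simp [ae_iff]
    filter_upwards [h0] with x hx
    have hxpos : 0 < ‖x‖ := norm_pos_iff.2 hx
    have hnp : 0 < -p := neg_pos.2 hp
    have hq' : ‖x‖ ^ q ≤ 1 + ‖x‖ ^ 2 := by
      rcases le_total ‖x‖ 1 with h1 | h1
      · exact (Real.rpow_le_one hxpos.le h1 hq.le).trans (by nlinarith)
      · have := Real.rpow_le_rpow_of_exponent_le h1 hq2
        rw [Real.rpow_two] at this
        linarith
    have hA : 0 ≤ 1 / q + 1 / -p := by positivity
    rw [powerLawKernel, if_neg hx]
    change _ ≤ ENNReal.ofReal _ * _ + _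
    rw [← ENNReal.ofReal_mul hA]
    by_cases hball : x ∈ Metric.ball (0 : EuclideanSpace ℝ (Fin d)) 1
    · rw [indicator_of_mem hball, ← ENNReal.ofReal_add (by positivity) (by positivity)]
      apply ENNReal.ofReal_le_ofReal
      have h1 : ‖x‖ ^ q / q ≤ (1 + ‖x‖ ^ 2) / q := by gcongr
      have h2 : 0 ≤ (1 + ‖x‖ ^ 2) / -p := by positivity
      have h3 : (1 / q + 1 / -p) * (1 + ‖x‖ ^ 2) = (1 + ‖x‖ ^ 2) / q + (1 + ‖x‖ ^ 2) / -p := by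
        ring
      rw [h3, div_neg (‖x‖ ^ p)]
      linarith
    · rw [indicator_of_notMem hball, add_zero]
      apply ENNReal.ofReal_le_ofReal
      have h1 : ‖x‖ ^ q / q ≤ (1 + ‖x‖ ^ 2) / q := by gcongr
      rw [mem_ball_zero_iff, not_lt] at hball
      have h2 : ‖x‖ ^ p ≤ 1 + ‖x‖ ^ 2 :=
        (Real.rpow_le_one_of_one_le_of_nonpos hball hp.le).trans (by nlinarith)
      have h2' : ‖x‖ ^ p / -p ≤ (1 + ‖x‖ ^ 2) / -p := by gcongr
      have h3 : (1 / q + 1 / -p) * (1 + ‖x‖ ^ 2) = (1 + ‖x‖ ^ 2) / q + (1 + ‖x‖ ^ 2) / -p := by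
        ring
      rw [div_neg (‖x‖ ^ p)] at h2'
      rw [h3]
      linarith

variable {φ : EuclideanSpace ℝ (Fin d) → ℝ}

/-- Continuity bounds `φ` on the unit ball and the decay bounds it outside, so `φ` is at most a
multiple of `(1 + |x|)^(-l)`. Integrability needs `l - 2 > d`, which follows from `l ≥ 2 * d + 1`
and `d ≥ 2`. -/
theorem IsAdmissibleMollifier.integrable_mul_one_add_norm_sq (hφ : IsAdmissibleMollifier φ)
    (hd : 2 ≤ d) : Integrable fun x => φ x * (1 + ‖x‖ ^ 2) := by
  obtain ⟨l, C, hl, hC, hdec⟩ := hφ.decay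
  have hl1 : 2 * (d : ℝ) + 1 ≤ l := (le_max_left _ _).trans hl
  have hd' : (2 : ℝ) ≤ d := by exact_mod_cast hd
  have hcont := hφ.smooth.continuous
  obtain ⟨D, hD⟩ := (isCompact_closedBall (0 : EuclideanSpace ℝ (Fin d)) 1).exists_bound_of_continuousOn
    hcont.continuousOn
  have hr : (Module.finrank ℝ (EuclideanSpace ℝ (Fin d)) : ℝ) < l - 2 := by
    rw [finrank_euclideanSpace_fin]
    linarith
  refine ((integrable_one_add_norm (μ := volume) hr).const_mul
    (max D C * 2 ^ l)).mono' (by fun_prop) (Eventually.of_forall fun x => ?_)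
  have hn := norm_nonneg x
  rw [Real.norm_of_nonneg (mul_nonneg (hφ.nonneg x) (by positivity))]
  have hbound : φ x ≤ max D C * 2 ^ l * (1 + ‖x‖) ^ (-l) := by
    have hscale : 2 ^ l * (1 + ‖x‖) ^ (-l) = ((1 + ‖x‖) / 2) ^ (-l) := by
      rw [Real.div_rpow (by positivity) (by positivity), Real.rpow_neg (by norm_num : (0:ℝ) ≤ 2),
        div_inv_eq_mul, mul_comm]
    rw [mul_assoc, hscale]
    rcases le_total ‖x‖ 1 with h1 | h1
    · have h2 : φ x ≤ D := (le_abs_self _).trans (hD x (by simpa using h1))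
      have h3 : 1 ≤ ((1 + ‖x‖) / 2) ^ (-l) :=
        Real.one_le_rpow_of_pos_of_le_one_of_nonpos (by positivity) (by linarith) (by linarith)
      calc φ x ≤ max D C := h2.trans (le_max_left _ _)
        _ ≤ _ := le_mul_of_one_le_right (hC.le.trans (le_max_right _ _)) h3
    · have hx : x ≠ 0 := norm_pos_iff.1 (by linarith)
      refine (hdec x hx).trans (mul_le_mul (le_max_right _ _) ?_ (by positivity)
        (hC.le.trans (le_max_right _ _)))
      exact Real.rpow_le_rpow_of_nonpos (by positivity) (by linarith) (by linarith)
  have hsq : 1 + ‖x‖ ^ 2 ≤ (1 + ‖x‖) ^ (2 : ℝ) := by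
    rw [Real.rpow_two]
    nlinarith
  calc φ x * (1 + ‖x‖ ^ 2) ≤ max D C * 2 ^ l * (1 + ‖x‖) ^ (-l) * (1 + ‖x‖) ^ (2 : ℝ) :=
        mul_le_mul hbound hsq (by positivity) ((hφ.nonneg x).trans hbound)
    _ = max D C * 2 ^ l * (1 + ‖x‖) ^ (-(l - 2)) := by
        rw [mul_assoc, ← Real.rpow_add (by positivity)]
        ring_nf

theorem IsAdmissibleMollifier.lintegral_rescaledMollifier_mul_ne_top
    (hφ : IsAdmissibleMollifier φ) (hd : 2 ≤ d) {ε : ℝ} (hε : 0 < ε) :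
    ∫⁻ x, ENNReal.ofReal (rescaledMollifier φ ε x) * ENNReal.ofReal (1 + ‖x‖ ^ 2) ≠ ⊤ := by
  have hint := (((hφ.integrable_mul_one_add_norm_sq hd).comp_smul
    (inv_ne_zero hε.ne')).const_mul ((ε ^ d)⁻¹ * (1 + ε ^ 2))).lintegral_lt_top
  refine ne_top_of_le_ne_top hint.ne (lintegral_mono fun x => ?_)
  have h0 := hφ.nonneg (ε⁻¹ • x)
  have hc : 0 ≤ (ε ^ d)⁻¹ := by positivity
  have hr : 0 ≤ rescaledMollifier φ ε x := mul_nonneg hc h0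
  rw [← ENNReal.ofReal_mul hr]
  apply ENNReal.ofReal_le_ofReal
  have hx : 1 + ‖x‖ ^ 2 ≤ (1 + ε ^ 2) * (1 + ‖ε⁻¹ • x‖ ^ 2) := by
    have : ‖x‖ = ε * ‖ε⁻¹ • x‖ := by
      rw [norm_smul, norm_inv, Real.norm_of_nonneg hε.le, mul_inv_cancel_left₀ hε.ne']
    rw [this]
    nlinarith [sq_nonneg ‖ε⁻¹ • x‖, sq_nonneg ε]
  calc rescaledMollifier φ ε x * (1 + ‖x‖ ^ 2)
      ≤ rescaledMollifier φ ε x * ((1 + ε ^ 2) * (1 + ‖ε⁻¹ • x‖ ^ 2)) := by gcongr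
    _ = _ := by rw [rescaledMollifier]; ring

theorem IsQuadraticallyBounded.regularizedKernel {K : EuclideanSpace ℝ (Fin d) → ℝ≥0∞}
    (hK : IsQuadraticallyBounded K) (hφ : IsAdmissibleMollifier φ) (hd : 2 ≤ d) {ε : ℝ}
    (hε : 0 < ε) : IsQuadraticallyBounded (regularizedKernel φ K ε) := by
  have hm := hφ.measurable_ofReal_rescaledMollifier ε
  have hi := hφ.lintegral_rescaledMollifier_mul_ne_top hd hε
  rw [_root_.regularizedKernel, lconvolution_comm]
  exact (hK.lconvolution hm hi).lconvolution hm hi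

end FiniteEnergy

theorem mainTheorem6 (d : ℕ) (p q : ℝ) (hdp : 2 - (d : ℝ) ≤ p) (hp : p < 0) (hq : 0 < q)
    (hq2 : q ≤ 2) (φ : EuclideanSpace ℝ (Fin d) → ℝ) (hφ : IsAdmissibleMollifier φ) :
    (∃ μ ∈ finiteSecondMoment d,
      IsMinOn (interactionEnergy (powerLawKernel d p q)) Set.univ μ) ∧
    ∃ ε₀ : ℝ, 0 < ε₀ ∧ ∀ ε : ℝ, 0 < ε → ε < ε₀ →
      ∃ μ ∈ finiteSecondMoment d,
        IsMinOn (interactionEnergy (regularizedKernel φ (powerLawKernel d p q) ε)) Set.univ μ := by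
  have hd : (2 : ℝ) < d := by linarith
  have hd2 : 2 ≤ d := by exact_mod_cast hd.le
  have hc := (continuous_powerLawKernel (d := d) hp hq).lowerSemicontinuous
  have ht := tendsto_powerLawKernel_cocompact (d := d) hp hq
  have hb := isQuadraticallyBounded_powerLawKernel (d := d) (by linarith) hp hq hq2
  exact ⟨exists_mem_finiteSecondMoment_isMinOn hc ht hb.exists_interactionEnergy_ne_top,
    -- The argument works for every `ε > 0`, so the threshold 1 is arbitrary.
    1, one_pos, fun ε hε _ => exists_mem_finiteSecondMoment_isMinOn (hc.regularizedKernel hφ ε)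
      (tendsto_regularizedKernel_cocompact hφ hc.measurable ht hε)
      (hb.regularizedKernel hφ hd2 hε).exists_interactionEnergy_ne_top⟩
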